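/- Let $k$ be a field of prime characteristic $p$. Let $\mathfrak g$ be a restricted Lie algebra over $k$ with $p$-map $x\mapsto x^{[p]}$, that is, $(\lambda x)^{[p]}=\lambda^p x^{[p]}$, $\mathrm{ad}_{x^{[p]}}=(\mathrm{ad}_x)^p$ and $(x+y)^{[p]}=x^{[p]}+y^{[p]}+\sum_{i=1}^{p-1}s_i(x,y)$, where $i\,s_i(x,y)$ is the coefficient of $t^{i-1}$ in $(\mathrm{ad}_{tx+y})^{p-1}(x)$, with $t$ an indeterminate. Let $\blacktriangleright$ be a post-Lie product on $\mathfrak g$: a bilinear operation such that, for all $x,y,z\in\mathfrak g$, $$x\blacktriangleright[y,z]=[x\blacktriangleright y,z]+[y,x\blacktriangleright z],\qquad [x,y]\blacktriangleright z=a(x,y,z)-a(y,x,z),$$ where $a(x,y,z)=x\blacktriangleright(y\blacktriangleright z)-(x\blacktriangleright y)\blacktriangleright z$. Put $x^{\bullet 1}=x$, $x^{\bullet (n+1)}=x\blacktriangleright x^{\bullet n}$, $[x_1\cdots x_n]=[x_1,[x_2,\cdots[x_{n-1},x_n]]]$ (equal to $x_1$ if $n=1$), and $$x^{[p]_\blacktriangleright}=x^{[p]}+\sum_{n=1}^{p-1}\frac1n\sum_{\substack{\ell_1+\cdots+\ell_n=p\\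 \ell_i\ge1}}\frac{(p-1)!}{(\ell_1-1)!\cdots(\ell_n-1)!}\prod_{v=1}^{n-1}(\ell_1+\cdots+\ell_v)^{-1}\,[x^{\bullet\ell_1}\cdots x^{\bullet\ell_n}].$$ Assume that $(\mathfrak g,\blacktriangleright)$ is trivially restricted: for all $x,y\in\mathfrak g$, $$x^{[p]_\blacktriangleright}\blacktriangleright y=\underbrace{x\blacktriangleright(\cdots(x}_{p}\blacktriangleright y)\cdots),\qquad y\blacktriangleright x^{[p]}=(\mathrm{ad}_x)^{p-1}(y\blacktriangleright x).$$ Let $\mathfrak u(\mathfrak g)$ be the universal enveloping algebra, with its coproduct $\Delta(E)=E_{(1)}\otimes E_{(2)}$ (the algebra morphism with $\Delta(x)=x\otimes1+1\otimes x$ for $x\in\mathfrak g$), let $I$ be the two-sided ideal of $\mathfrak u(\mathfrak g)$ generated by the elements $x^p-x^{[p]}$, $x\in\mathfrak g$, and let $\pi:\mathfrak u(\mathfrak g)\to\mathfrak u_p(\mathfrak g)=\mathfrak u(\mathfrak g)/I$ be the projection onto the restricted enveloping algebra. Then: 1. There is exactly one bilinear operation $\blacktriangleright$ on $\mathfrak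 u(\mathfrak g)$ that extends the post-Lie product of $\mathfrak g$ and satisfies $1\blacktriangleright F=F$, $\;xE\blacktriangleright F=x\blacktriangleright(E\blacktriangleright F)-(x\blacktriangleright E)\blacktriangleright F$ and $E\blacktriangleright F_1F_2=(E_{(1)}\blacktriangleright F_1)(E_{(2)}\blacktriangleright F_2)$ for all $x\in\mathfrak g$ and $E,F,F_1,F_2\in\mathfrak u(\mathfrak g)$. 2. This operation preserves $I$: if $E\in I$ and $F\in\mathfrak u(\mathfrak g)$, then $E\blacktriangleright F\in I$ and $F\blacktriangleright E\in I$. 3. It descends to $\mathfrak u_p(\mathfrak g)$: there is exactly one bilinear operation $\overline{\blacktriangleright}$ on $\mathfrak u_p(\mathfrak g)$ with $\pi(E)\,\overline{\blacktriangleright}\,\pi(F)=\pi(E\blacktriangleright F)$ for all $E,F\in\mathfrak u(\mathfrak g)$. -/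

import Mathlib

open scoped TensorProduct Nat

noncomputable section

namespace RestrictedPostLie

attribute [local instance 100] LieRing.ofAssociativeRing

section Lie

variable (k : Type*) (g : Type*) [Field k] [LieRing g] [LieAlgebra k g]

/-! ### Restricted Lie algebras -/

/-- The linear map `g[t] = k[t] ⊗ g → g` taking the coefficient of `t ^ n`. -/
def coeffMap (n : ℕ) : Polynomial k ⊗[k] g →ₗ[k] g :=
  (TensorProduct.lid k g).toLinearMap ∘ₗ LinearMap.rTensor g (Polynomial.lcoeff k n)

variable {g} in
/-- Jacobson's `s_i(x, y)`: the element such that `i • s_i(x, y)` is the coefficient of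
`t ^ (i - 1)` in `(ad (t x + y)) ^ (p - 1) x`, computed in the Lie algebra `k[t] ⊗ g`
over `k[t]`, for `1 ≤ i ≤ p - 1`. -/
def jacobsonS (p i : ℕ) (x y : g) : g :=
  (i : k)⁻¹ • coeffMap k g (i - 1)
    (((LieAlgebra.ad (Polynomial k) (Polynomial k ⊗[k] g)
        ((Polynomial.X : Polynomial k) ⊗ₜ[k] x + (1 : Polynomial k) ⊗ₜ[k] y)) ^ (p - 1))
      ((1 : Polynomial k) ⊗ₜ[k] x))

/-- A restricted Lie algebra structure (a `p`-map `x ↦ x^[p]`) on the Lie algebra `g` over a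
field `k` of characteristic `p`. -/
structure PMap (p : ℕ) where
  toFun : g → g
  map_smul : ∀ (c : k) (x : g), toFun (c • x) = c ^ p • toFun x
  ad_map : ∀ x : g, LieAlgebra.ad k g (toFun x) = (LieAlgebra.ad k g x) ^ p
  map_add : ∀ x y : g,
    toFun (x + y) = toFun x + toFun y + ∑ i ∈ Finset.Icc 1 (p - 1), jacobsonS k p i x y

/-! ### Post-Lie algebras -/

/-- A post-Lie product `x ▶ y = P.op x y` on the Lie algebra `g`. -/
structure PostLieProduct where
  op : g →ₗ[k] g →ₗ[k] g
  op_lie : ∀ x y z : g, op x ⁅y, z⁆ = ⁅op x y, z⁆ + ⁅y, op x z⁆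
  lie_op : ∀ x y z : g,
    op ⁅x, y⁆ z = (op x (op y z) - op (op x y) z) - (op y (op x z) - op (op y x) z)

variable {g} in
/-- The right-nested bracket `[x₁, [x₂, … [xₙ₋₁, xₙ]]]` of a list; it is `x₁` when `n = 1`. -/
def nestedBracket : List g → g
  | [] => 0
  | [x] => x
  | x :: y :: l => ⁅x, nestedBracket (y :: l)⁆

variable {k g} {p : ℕ}

/-- `x ▶ (x ▶ ⋯ (x ▶ x))` with `n ≥ 1` occurrences of `x`. -/
def PostLieProduct.bullet (P : PostLieProduct k g) (x : g) (n : ℕ) : g :=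
  ((P.op x) ^ (n - 1)) x

/-- The sub-adjacent `p`-map: `x^[p]` plus the sum over `1 ≤ n ≤ p - 1` and over all
`(ℓ₁, …, ℓₙ)` with `ℓᵢ ≥ 1` and `ℓ₁ + ⋯ + ℓₙ = p` of
`(1 / n) * (p - 1)! / ∏ᵢ (ℓᵢ - 1)! * ∏_{1 ≤ v ≤ n - 1} (ℓ₁ + ⋯ + ℓᵥ)⁻¹`
times the nested bracket of the elements `bullet x ℓᵢ`. -/
def subadjacentPMap (R : PMap k g p) (P : PostLieProduct k g) (x : g) : g :=
  R.toFun x + ∑ n ∈ Finset.Icc 1 (p - 1), (n : k)⁻¹ •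
    ∑ c : Composition p with c.length = n,
      ((((p - 1)! : ℕ) : k) / (((c.blocks.map fun l => (l - 1)!).prod : ℕ) : k) *
          ∏ v ∈ Finset.Icc 1 (n - 1), (c.sizeUpTo v : k)⁻¹) •
        nestedBracket (c.blocks.map (P.bullet x))

/-- The post-Lie algebra `(g, P)` over the restricted Lie algebra `(g, R)` is trivially
restricted. -/
structure TriviallyRestricted (R : PMap k g p) (P : PostLieProduct k g) : Prop where
  subadjacent_op : ∀ x y : g, P.op (subadjacentPMap R P x) y = ((P.op x) ^ p) y
  op_pMap : ∀ x y : g, P.op y (R.toFun x) = ((LieAlgebra.ad k g x) ^ (p - 1)) (P.op y x)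

/-! ### Enveloping algebras -/

variable (k g) in
/-- The universal enveloping algebra of `g`. -/
abbrev U := UniversalEnvelopingAlgebra k g

variable (k) in
/-- The canonical map `g → U(g)`. -/
def incl (x : g) : U k g := UniversalEnvelopingAlgebra.ι k x

variable (k g) in
/-- The Lie algebra morphism `g → U(g) ⊗ U(g)`, `x ↦ x ⊗ 1 + 1 ⊗ x`. -/
def primitiveHom : g →ₗ⁅k⁆ U k g ⊗[k] U k g where
  toFun x := incl k x ⊗ₜ[k] 1 + 1 ⊗ₜ[k] incl k x
  map_add' x y := by
    simp only [incl, map_add, TensorProduct.add_tmul, TensorProduct.tmul_add]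
    abel
  map_smul' c x := by
    simp only [incl, map_smul, RingHom.id_apply, smul_add, TensorProduct.smul_tmul',
      TensorProduct.tmul_smul]
  map_lie' {x y} := by
    simp only [incl, LieHom.map_lie, LieRing.of_associative_ring_bracket,
      TensorProduct.sub_tmul, TensorProduct.tmul_sub, mul_add, add_mul,
      Algebra.TensorProduct.tmul_mul_tmul, one_mul, mul_one]
    abel

variable (k g) in
/-- The coproduct of `U(g)`: the algebra morphism with `Δ x = x ⊗ 1 + 1 ⊗ x` for `x` in `g`. -/
def coproduct : U k g →ₐ[k] U k g ⊗[k] U k g :=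
  UniversalEnvelopingAlgebra.lift k (primitiveHom k g)

/-- The bilinear operation `T E F = E ▶ F` on `U(g)` is the extension of the post-Lie product:
it restricts to it on `g` and satisfies
`1 ▶ F = F`, `(x E) ▶ F = x ▶ (E ▶ F) - (x ▶ E) ▶ F` for `x` in `g`, and
`E ▶ (F₁ F₂) = (E₍₁₎ ▶ F₁) (E₍₂₎ ▶ F₂)` in Sweedler notation. -/
structure IsEnvelopeExtension (P : PostLieProduct k g)
    (T : U k g →ₗ[k] U k g →ₗ[k] U k g) : Prop where
  incl_incl : ∀ x y : g, T (incl k x) (incl k y) = incl k (P.op x y)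
  one_left : ∀ F : U k g, T 1 F = F
  incl_mul : ∀ (x : g) (E F : U k g),
    T (incl k x * E) F = T (incl k x) (T E F) - T (T (incl k x) E) F
  right_mul : ∀ E F₁ F₂ : U k g,
    T E (F₁ * F₂) =
      LinearMap.mul' k (U k g) (TensorProduct.map (T.flip F₁) (T.flip F₂) (coproduct k g E))

/-- The two-sided ideal of `U(g)` generated by the elements `x ^ p - x^[p]`, `x` in `g`. -/
def restrictedIdeal (R : PMap k g p) : TwoSidedIdeal (U k g) :=
  TwoSidedIdeal.span (Set.range fun x : g => incl k x ^ p - incl k (R.toFun x))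

/-- The restricted enveloping algebra `u_p(g)`, the quotient of `U(g)` by `restrictedIdeal`. -/
abbrev RestrictedEnvelope (R : PMap k g p) := (restrictedIdeal R).ringCon.Quotient

/-- The canonical projection `U(g) → u_p(g)`. -/
def proj (R : PMap k g p) : U k g →ₐ[k] RestrictedEnvelope R :=
  RingCon.mkₐ k (restrictedIdeal R).ringCon

end Lie

end RestrictedPostLie

end

noncomputable section

namespace RestrictedPostLie

attribute [local instance 100] LieRing.ofAssociativeRing

/-! ### Powers, commutators and derivations in characteristic `p`. -/

section RingIdentities

/-! Let `L_x` be the derivation of `U(g)` extending `x ▶ ·`. The extension axioms are equivalent to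
the recursion `T 1 = 1`, `T (x E) = L_x T(E) - T (L_x E)` (`IsRecursive`). A solution is unique,
since the recursion determines it letter by letter (`recursive_map_mem`). The rule for products
follows because `L_x` is both a derivation and a coderivation.

Existence is the delicate point: the recursion must respect the relations of `U(g)`. The derivations
`L_x` represent the sub-adjacent Lie algebra. If `Θ` solves the recursion with values in `M`, set
`f_E(w) = Θ(w · E)` for `w` in the enveloping algebra of the sub-adjacent algebra. The recursion
forces a formula for `f_{xE}` in terms of `x` and `f_E`, namely `coaction`. These operators
represent `g` (`coaction_lie`), so they lift to `U(g)`. Acting on `f_1` and evaluating at `1` gives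
`Θ` (`exists_recursive_map`).

For the ideal, put `c = x^p - x^[p]`, which is central, so `I` is spanned by the products `E c`. The
second restrictedness condition gives `L_y c = 0`. The first gives `T c = 0` (`relation_eq_zero`):
the recursion yields `T ((x + L_x)^p 1) = L_x^p`, and Jacobson's formula for the `p`-th power of a
sum (`add_pow_char_eq`), applied to left multiplication by `x` and `L_x`, evaluates `(x + L_x)^p 1`
as `x^p` plus the correction terms of the sub-adjacent `p`-map. Both invariance statements then
follow by the recursion, and the operation passes to the quotient. -/

theorem cast_choose_pred_char (R : Type*) [Ring R] (p : ℕ) [hp : Fact p.Prime] [CharP R p] {m : ℕ}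
    (hm : m < p) : ((p - 1).choose m : R) = (-1) ^ m := by
  induction m with
  | zero => simp
  | succ m ih =>
    have h1 : p.choose (m + 1) = (p - 1).choose m + (p - 1).choose (m + 1) := by
      conv_lhs => rw [← Nat.sub_add_cancel hp.out.one_le, Nat.choose_succ_succ]
    have h2 : ((p.choose (m + 1) : ℕ) : R) = 0 :=
      (CharP.cast_eq_zero_iff R p _).2 (hp.out.dvd_choose_self (by omega) hm)
    rw [h1, Nat.cast_add, ih (by omega)] at h2
    rw [pow_succ, mul_neg_one]
    exact (neg_eq_of_add_eq_zero_right h2).symm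

/-- Expand the right side binomially: modulo `p` the coefficient `(p-1 choose i)` is `(-1)^i`, which
cancels the signs of the powers of `-b`. -/
theorem geom_sum_char {R : Type*} [Ring R] (p : ℕ) [hp : Fact p.Prime] [CharP R p] {a b : R}
    (h : Commute a b) : ∑ i ∈ Finset.range p, a ^ i * b ^ (p - 1 - i) = (a - b) ^ (p - 1) := by
  rw [sub_eq_add_neg, (h.neg_right).add_pow, Nat.sub_add_cancel hp.out.one_le]
  refine Finset.sum_congr rfl fun i hi => ?_
  rw [Finset.mem_range] at hi
  -- Reading this off the binomial coefficient at `m = p - 1` covers `p = 2` as well.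
  have h1 : (-1 : R) ^ (p - 1) = 1 := by
    have := cast_choose_pred_char R p (m := p - 1) (by have := hp.out.one_le; omega)
    simpa using this.symm
  rw [cast_choose_pred_char R p hi, neg_pow b, mul_assoc, mul_assoc,
    (Commute.neg_one_left _).pow_left _ |>.eq, mul_assoc, ← pow_add, Nat.add_sub_of_le (by omega), h1, mul_one]

/-- The inner derivation `b ↦ a * b - b * a`. -/
def inner (k : Type*) {A : Type*} [Field k] [Ring A] [Algebra k A] (a : A) : Module.End k A :=
  LinearMap.mulLeft k a - LinearMap.mulRight k a

section
variable {k : Type*} {A : Type*} [Field k] [Ring A] [Algebra k A]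

theorem inner_apply (a b : A) : inner k a b = a * b - b * a := rfl

theorem inner_add (a b : A) : inner k (a + b) = inner k a + inner k b := by
  ext c
  simp only [inner_apply, LinearMap.add_apply]
  noncomm_ring

theorem inner_mul_inner (a b : A) :
    inner k a * inner k b = inner k (a * b - b * a) + inner k b * inner k a := by
  ext c
  simp only [inner_apply, LinearMap.add_apply, Module.End.mul_apply]
  noncomm_ring

theorem leibniz_pow (d : A →+ A) (hd : ∀ a b, d (a * b) = d a * b + a * d b) (a : A) (n : ℕ) :
    d (a ^ n) = ∑ i ∈ Finset.range n, a ^ i * d a * a ^ (n - 1 - i) := by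
  induction n with
  | zero => simpa using hd 1 1
  | succ n ih =>
    rw [pow_succ, hd, ih, Finset.sum_range_succ, Finset.sum_mul]
    congr 1
    · refine Finset.sum_congr rfl fun i hi => ?_
      rw [Finset.mem_range] at hi
      rw [mul_assoc, ← pow_succ]
      congr 2
      omega
    · simp

/-- Left and right multiplication by `a` commute, so `geom_sum_char` applies to their difference. -/
theorem inner_pow_pred (p : ℕ) [Fact p.Prime] [CharP k p] (a b : A) :
    ((inner k a) ^ (p - 1)) b = ∑ i ∈ Finset.range p, a ^ i * b * a ^ (p - 1 - i) := by
  nontriviality A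
  have : CharP (Module.End k A) p :=
    charP_of_injective_algebraMap (algebraMap k (Module.End k A)).injective p
  rw [inner, ← geom_sum_char p (LinearMap.commute_mulLeft_right a a), LinearMap.sum_apply]
  refine Finset.sum_congr rfl fun i _ => ?_
  rw [Module.End.mul_apply, LinearMap.pow_mulLeft, LinearMap.pow_mulRight,
    LinearMap.mulLeft_apply, LinearMap.mulRight_apply, mul_assoc]

theorem inner_pow_char (p : ℕ) [Fact p.Prime] [CharP k p] (a : A) :
    (inner k a) ^ p = inner k (a ^ p) := by
  nontriviality A
  have : CharP (Module.End k A) p :=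
    charP_of_injective_algebraMap (algebraMap k (Module.End k A)).injective p
  rw [inner, sub_pow_char_of_commute p (LinearMap.commute_mulLeft_right a a),
    LinearMap.pow_mulLeft, LinearMap.pow_mulRight, inner]

theorem leibniz_pow_char (p : ℕ) [Fact p.Prime] [CharP k p] (d : A →+ A)
    (hd : ∀ a b, d (a * b) = d a * b + a * d b) (a : A) :
    d (a ^ p) = ((inner k a) ^ (p - 1)) (d a) := by
  rw [leibniz_pow d hd, inner_pow_pred]

end

section
variable {S : Type*} [Ring S]

/-- In terms of exponential generating functions, `F = exp(t(ξ+D)) exp(-tD)`. The hypothesis `hF` is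
`F' = F · exp(tD) ξ exp(-tD)` and the conclusion is `F' = (ξ+D) F - F D`. Stating this
coefficientwise up to `N` avoids dividing by `p`. -/
theorem add_comm_recursion {ξ D : S} {η F : ℕ → S} {N : ℕ} (h0 : η 0 = ξ)
    (hη : ∀ j, D * η j = η (j + 1) + η j * D) (hF0 : F 0 = 1)
    (hF : ∀ m < N, F (m + 1) =
      ∑ ij ∈ Finset.HasAntidiagonal.antidiagonal m, m.choose ij.1 • (F ij.1 * η ij.2))
    {m : ℕ} (hm : m < N) :
    F (m + 1) = (ξ + D) * F m - F m * D := by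
  induction m using Nat.strong_induction_on with
  | _ m ih =>
    rcases m with _ | m
    · rw [hF 0 hm]
      simp [hF0, h0]
    · rw [hF (m + 1) hm, Finset.sum_antidiagonal_choose_succ_nsmul (fun i j => F i * η j)]
      conv_rhs => rw [hF m (by omega), Finset.mul_sum, Finset.sum_mul, ← Finset.sum_sub_distrib]
      rw [← Finset.sum_add_distrib]
      refine Finset.sum_congr rfl fun ij hij => ?_
      rw [Finset.HasAntidiagonal.mem_antidiagonal] at hij
      rw [Nat.choose_symm_of_eq_add hij.symm]
      rw [ih ij.1 (by omega) (by omega), mul_smul_comm, smul_mul_assoc, ← smul_sub, ← smul_add]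
      congr 1
      have := hη ij.2
      rw [← sub_eq_iff_eq_add] at this
      rw [← this]
      noncomm_ring

/-- The coefficient form of `exp(t(ξ+D)) = F · exp(tD)`. -/
theorem add_pow_eq_sum {ξ D : S} {η F : ℕ → S} {N : ℕ} (h0 : η 0 = ξ)
    (hη : ∀ j, D * η j = η (j + 1) + η j * D) (hF0 : F 0 = 1)
    (hF : ∀ m < N, F (m + 1) =
      ∑ ij ∈ Finset.HasAntidiagonal.antidiagonal m, m.choose ij.1 • (F ij.1 * η ij.2))
    {m : ℕ} (hm : m ≤ N) :
    (ξ + D) ^ m = ∑ ij ∈ Finset.HasAntidiagonal.antidiagonal m, m.choose ij.1 • (F ij.1 * D ^ ij.2) := by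
  induction m with
  | zero => simp [hF0]
  | succ m ih =>
    rw [pow_succ', ih (by omega), Finset.sum_antidiagonal_choose_succ_nsmul (fun i j => F i * D ^ j),
      ← Finset.sum_add_distrib, Finset.mul_sum]
    refine Finset.sum_congr rfl fun ij hij => ?_
    rw [Finset.HasAntidiagonal.mem_antidiagonal] at hij
    rw [Nat.choose_symm_of_eq_add hij.symm,
      add_comm_recursion h0 hη hF0 hF (show ij.1 < N by omega), mul_smul_comm, ← smul_add]
    congr 1
    rw [pow_succ']
    noncomm_ring

end
end RingIdentities

/-! ### Sums over compositions and their weights. -/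

section CompositionSums

-- Split off the last block, written `j + 1` because blocks are positive.
open Finset.HasAntidiagonal in
theorem sum_composition_succ {M : Type*} [AddCommMonoid M] (f : List ℕ → M) (m : ℕ) :
    ∑ c : Composition (m + 1), f c.blocks =
      ∑ ij ∈ antidiagonal m, ∑ c : Composition ij.1, f (c.blocks ++ [ij.2 + 1]) := by
  rw [Finset.sum_sigma']
  symm
  have hsum : ∀ a ∈ (antidiagonal m).sigma fun ij => (Finset.univ : Finset (Composition ij.1)),
      (a.2.blocks ++ [a.1.2 + 1]).sum = m + 1 := by
    intro a ha
    rw [Finset.mem_sigma, mem_antidiagonal] at ha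
    rw [List.sum_append, a.2.blocks_sum, List.sum_singleton, ← ha.1, add_assoc]
  refine Finset.sum_bij (fun a ha => ⟨a.2.blocks ++ [a.1.2 + 1], ?_, hsum a ha⟩) ?_ ?_ ?_ ?_
  · intro i hi
    rw [List.mem_append, List.mem_singleton] at hi
    rcases hi with hi | rfl
    · exact a.2.blocks_pos hi
    · exact Nat.succ_pos _
  · exact fun _ _ => Finset.mem_univ _
  · rintro ⟨⟨i, j⟩, c⟩ _ ⟨⟨i', j'⟩, c'⟩ _ h
    have h1 := congrArg Composition.blocks h
    simp only at h1
    obtain ⟨h2, h3⟩ := List.append_inj' h1 rfl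
    have h4 : i = i' := c.blocks_sum.symm.trans ((congrArg List.sum h2).trans c'.blocks_sum)
    have h5 : j = j' := by simpa using h3
    subst h4 h5
    rw [Composition.ext h2]
  · intro c _
    have hne : c.blocks ≠ [] := fun h => by simpa [h] using c.blocks_sum
    have hdl := List.dropLast_append_getLast hne
    have hpos : 0 < c.blocks.getLast hne := c.blocks_pos (List.getLast_mem hne)
    have hs : c.blocks.dropLast.sum + c.blocks.getLast hne = m + 1 := by
      rw [← List.sum_singleton (x := c.blocks.getLast hne), ← List.sum_append, hdl, c.blocks_sum]
    refine ⟨⟨⟨c.blocks.dropLast.sum, c.blocks.getLast hne - 1⟩,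
      ⟨c.blocks.dropLast, fun hi => c.blocks_pos (List.mem_of_mem_dropLast hi), rfl⟩⟩, ?_, ?_⟩
    · rw [Finset.mem_sigma, mem_antidiagonal]
      exact ⟨by simp only; omega, Finset.mem_univ _⟩
    · ext1
      simp only
      rw [Nat.sub_add_cancel hpos, hdl]
  · exact fun _ _ => rfl

variable (k : Type*) [Field k]

/-- The inverse of the product of the proper and improper partial sums and of the numbers
`(l - 1)!`, over the entries `l` of a list. -/
def blockWeight (l : List ℕ) : k :=
  (∏ v ∈ Finset.Icc 1 l.length, ((l.take v).sum : k)⁻¹) *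
    (((l.map fun i => (i - 1)!).prod : ℕ) : k)⁻¹

theorem blockWeight_append (l : List ℕ) (j : ℕ) :
    blockWeight k (l ++ [j + 1]) =
      ((l.sum + j + 1 : ℕ) : k)⁻¹ * (j ! : k)⁻¹ * blockWeight k l := by
  have h : ∀ v ∈ Finset.Icc 1 l.length,
      (((l ++ [j + 1]).take v).sum : k)⁻¹ = ((l.take v).sum : k)⁻¹ := by
    intro v hv
    rw [List.take_append_of_le_length (Finset.mem_Icc.1 hv).2]
  rw [blockWeight, blockWeight, List.length_append, List.length_singleton,
    Finset.prod_Icc_succ_top (by omega), Finset.prod_congr rfl h, List.take_of_length_le (by simp)]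
  simp only [List.map_append, List.map_cons, List.map_nil, List.prod_append, List.prod_singleton,
    Nat.add_sub_cancel, List.sum_append, List.sum_singleton, Nat.cast_mul, mul_inv, add_assoc]
  ring

/-- The coefficient of a nested bracket in the sub-adjacent `p`-map. -/
def bracketCoeff (p : ℕ) (l : List ℕ) : k :=
  (((p - 1)! : ℕ) : k) / (((l.map fun i => (i - 1)!).prod : ℕ) : k) *
    ∏ v ∈ Finset.Icc 1 (l.length - 1), ((l.take v).sum : k)⁻¹

/-- The product in `bracketCoeff` stops before the full sum, so for a composition of `p` it never
inverts `p = 0`; what remains is the weight of the list without its last block. -/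
theorem bracketCoeff_append {p : ℕ} (l : List ℕ) (j : ℕ) :
    bracketCoeff k p (l ++ [j + 1]) =
      (((p - 1)! : ℕ) : k) * (j ! : k)⁻¹ * blockWeight k l := by
  have h : ∀ v ∈ Finset.Icc 1 l.length,
      (((l ++ [j + 1]).take v).sum : k)⁻¹ = ((l.take v).sum : k)⁻¹ := by
    intro v hv
    rw [List.take_append_of_le_length (Finset.mem_Icc.1 hv).2]
  rw [bracketCoeff, blockWeight, List.length_append, List.length_singleton, Nat.add_sub_cancel,
    Finset.prod_congr rfl h]
  simp only [List.map_append, List.map_cons, List.map_nil, List.prod_append, List.prod_singleton,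
    Nat.add_sub_cancel, Nat.cast_mul, div_eq_mul_inv, mul_inv]
  ring

variable {k}

theorem cast_factorial_ne_zero (p : ℕ) [hp : Fact p.Prime] [CharP k p] {m : ℕ} (hm : m < p) :
    (m ! : k) ≠ 0 := by
  rw [Ne, CharP.cast_eq_zero_iff k p, hp.out.dvd_factorial]
  omega

theorem cast_ne_zero_of_lt (p : ℕ) [CharP k p] {m : ℕ} (h0 : 0 < m) (hm : m < p) :
    (m : k) ≠ 0 := by
  rw [Ne, CharP.cast_eq_zero_iff k p]
  exact Nat.not_dvd_of_pos_of_lt h0 hm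

variable {S : Type*} [Ring S] [Algebra k S]

/-- The sum of the products `∏ η (lᵢ - 1)` over the compositions of `m`, suitably weighted. -/
def weightedSum (η : ℕ → S) (m : ℕ) : S :=
  ∑ c : Composition m, ((m ! : k) * blockWeight k c.blocks) •
    (c.blocks.map fun l => η (l - 1)).prod

theorem weightedSum_zero (η : ℕ → S) : weightedSum (k := k) η 0 = 1 := by
  have h : ∀ c : Composition 0, c.blocks = [] := fun c => by
    rw [Composition.blocks_eq_nil]
  rw [weightedSum, Finset.sum_congr rfl fun c _ => by rw [h c]]
  simp [blockWeight, composition_card]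

theorem factorial_mul_eq (p : ℕ) [hp : Fact p.Prime] [CharP k p] {m i j : ℕ} (hm : m < p)
    (h : i + j = m) : (m ! : k) * (j ! : k)⁻¹ = (m.choose i : k) * (i ! : k) := by
  have h1 := Nat.add_choose_mul_factorial_mul_factorial i j
  rw [h] at h1
  rw [Nat.choose_symm_of_eq_add h.symm, ← h1]
  push_cast
  rw [mul_assoc, mul_inv_cancel₀ (cast_factorial_ne_zero p (by omega)), mul_one]

/-- This is the recursion required by `add_pow_eq_sum`. The bound on `m` makes `m + 1` invertible in
`k`. -/
theorem weightedSum_succ (p : ℕ) [hp : Fact p.Prime] [CharP k p] (η : ℕ → S) {m : ℕ}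
    (hm : m < p - 1) : weightedSum (k := k) η (m + 1) =
      ∑ ij ∈ Finset.HasAntidiagonal.antidiagonal m,
        m.choose ij.1 • (weightedSum (k := k) η ij.1 * η ij.2) := by
  rw [weightedSum, sum_composition_succ fun l =>
    (((m + 1)! : k) * blockWeight k l) • (l.map fun l => η (l - 1)).prod]
  refine Finset.sum_congr rfl fun ij hij => ?_
  rw [Finset.HasAntidiagonal.mem_antidiagonal] at hij
  rw [weightedSum, Finset.sum_mul, Finset.smul_sum]
  refine Finset.sum_congr rfl fun c _ => ?_
  rw [blockWeight_append, c.blocks_sum, hij, List.map_append, List.prod_append, List.map_singleton,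
    List.prod_singleton, Nat.add_sub_cancel, smul_mul_assoc, ← Nat.cast_smul_eq_nsmul k, smul_smul]
  congr 1
  have h1 := factorial_mul_eq (k := k) p (show m < p by omega) hij
  rw [← mul_assoc (m.choose ij.1 : k), ← h1, Nat.factorial_succ]
  have h2 := cast_ne_zero_of_lt (k := k) p (Nat.succ_pos m) (by omega)
  rw [Nat.succ_eq_add_one] at h2
  rw [Nat.cast_mul]
  field_simp

end CompositionSums

/-! ### Nested brackets as products of inner derivations. -/

section NestedBracket

variable {k L : Type*} [Field k] [LieRing L]

theorem nestedBracket_map {M : Type*} [LieRing M] (f : L →+ M)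
    (hf : ∀ x y, f ⁅x, y⁆ = ⁅f x, f y⁆) : ∀ l : List L,
    nestedBracket (l.map f) = f (nestedBracket l)
  | [] => by simp [nestedBracket]
  | [x] => by simp [nestedBracket]
  | x :: y :: l => by
    have := nestedBracket_map f hf (y :: l)
    rw [List.map_cons] at this
    rw [List.map_cons, List.map_cons, nestedBracket, this, nestedBracket, hf]

theorem nestedBracket_cons (x : L) {l : List L} (h : l ≠ []) :
    nestedBracket (x :: l) = ⁅x, nestedBracket l⁆ := by
  obtain ⟨y, l, rfl⟩ := List.exists_cons_of_ne_nil h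
  rw [nestedBracket]

theorem nestedBracket_append_singleton {A : Type*} [Ring A] [Algebra k A] (l : List A) (a : A) :
    nestedBracket (l ++ [a]) = (l.map (inner k)).prod a := by
  induction l with
  | nil => simp [nestedBracket]
  | cons x l ih =>
    rw [List.cons_append, nestedBracket_cons _ (by simp), ih, List.map_cons, List.prod_cons,
      Module.End.mul_apply, inner_apply, LieRing.of_associative_ring_bracket]

-- The central variable `X` counts the inner derivations applied.
open Polynomial in
theorem prod_inner_X_mul_C {A : Type*} [Ring A] [Algebra k A] (y : ℕ → A) (l : List ℕ) (a : A) :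
    (l.map fun i => inner k (X * C (y (i - 1)))).prod (C a) =
      X ^ l.length * C (nestedBracket (l.map (fun i => y (i - 1)) ++ [a])) := by
  rw [nestedBracket_append_singleton (k := k)]
  induction l with
  | nil => simp
  | cons x l ih =>
    rw [List.map_cons, List.prod_cons, Module.End.mul_apply, ih, List.map_cons, List.map_cons,
      List.prod_cons, Module.End.mul_apply, inner_apply, inner_apply, map_sub, map_mul, map_mul,
      List.length_cons, mul_sub]
    congr 1
    · rw [pow_succ', mul_assoc, mul_assoc, ← mul_assoc (C _) (X ^ _), ← X_pow_mul, mul_assoc]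
    · rw [pow_succ, mul_assoc, mul_assoc, ← mul_assoc (C _) X, ← X_mul, mul_assoc]

end NestedBracket

/-! ### Jacobson's formula with explicit coefficients. -/

section PowerFormula

open Polynomial

variable {k A : Type*} [Field k] [Ring A] [Algebra k A] (p : ℕ) [hp : Fact p.Prime] [CharP k p]
  {ξ D : A} {y : ℕ → A}

theorem inner_C_pow_apply (h0 : y 0 = ξ) (hy : ∀ j, y (j + 1) = D * y j - y j * D) (j : ℕ) :
    ((inner k (C D : A[X])) ^ j) (C ξ) = C (y j) := by
  induction j with
  | zero => simp [h0]
  | succ j ih => rw [pow_succ', Module.End.mul_apply, ih, inner_apply, hy, map_sub, map_mul, map_mul]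

theorem inner_pow_eq_sum (h0 : y 0 = ξ) (hy : ∀ j, y (j + 1) = D * y j - y j * D) :
    ((inner k (X * C ξ + C D : A[X])) ^ (p - 1)) (C ξ) =
      ∑ c : Composition p, bracketCoeff k p c.blocks •
        (X ^ (c.length - 1) * C (nestedBracket (c.blocks.map fun l => y (l - 1)))) := by
  have hη : ∀ j, inner k (C D : A[X]) * inner k (X * C (y j)) =
      inner k (X * C (y (j + 1))) + inner k (X * C (y j)) * inner k (C D : A[X]) := by
    intro j
    rw [inner_mul_inner, hy]
    congr 2
    rw [map_sub, map_mul, map_mul, mul_sub, ← mul_assoc, ← X_mul, mul_assoc, mul_assoc]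
  have hp1 : p - 1 + 1 = p := Nat.sub_add_cancel hp.out.one_le
  rw [inner_add, add_pow_eq_sum (η := fun j => inner k (X * C (y j)))
    (F := weightedSum (k := k) fun j => inner k (X * C (y j))) (N := p - 1) (by rw [h0]) hη
    (weightedSum_zero _) (fun m hm => weightedSum_succ p _ hm) le_rfl]
  have key := sum_composition_succ (fun l => bracketCoeff k p l •
        (X ^ (l.length - 1) * C (nestedBracket (l.map fun l => y (l - 1))) : A[X])) (p - 1)
  rw [hp1] at key
  refine Eq.trans ?_ key.symm
  rw [LinearMap.sum_apply]
  refine Finset.sum_congr rfl fun ij hij => ?_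
  rw [Finset.HasAntidiagonal.mem_antidiagonal] at hij
  rw [LinearMap.smul_apply, Module.End.mul_apply, inner_C_pow_apply h0 hy, weightedSum,
    LinearMap.sum_apply, Finset.smul_sum]
  refine Finset.sum_congr rfl fun c _ => ?_
  rw [LinearMap.smul_apply, prod_inner_X_mul_C, bracketCoeff_append,
    factorial_mul_eq p (by have := hp.out.pos; omega) hij, ← Nat.cast_smul_eq_nsmul k, smul_smul,
    ← mul_assoc, List.length_append, List.length_singleton, Nat.add_sub_cancel, List.map_append,
    List.map_singleton, Nat.add_sub_cancel]

/-- Differentiating `(Xξ + D)^p` in `X` gives `ad(Xξ + D)^(p-1) ξ`, which `inner_pow_eq_sum`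
expands. Comparing coefficients of `X^(n-1)` produces the factor `1/n`. -/
theorem coeff_X_mul_add_pow (h0 : y 0 = ξ) (hy : ∀ j, y (j + 1) = D * y j - y j * D) {n : ℕ}
    (hn : n ∈ Finset.Icc 1 (p - 1)) :
    ((X * C ξ + C D : A[X]) ^ p).coeff n = (n : k)⁻¹ •
      ∑ c : Composition p with c.length = n, bracketCoeff k p c.blocks •
        nestedBracket (c.blocks.map fun l => y (l - 1)) := by
  rw [Finset.mem_Icc] at hn
  have hn0 : (n : k) ≠ 0 := cast_ne_zero_of_lt p (by omega) (by omega)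
  rw [eq_inv_smul_iff₀ hn0]
  have h1 := leibniz_pow_char (k := k) p (derivative (R := A)).toAddMonoidHom
    (fun a b => derivative_mul) (X * C ξ + C D : A[X])
  have h2 : derivative (R := A) (X * C ξ + C D) = C ξ := by simp
  simp only [LinearMap.toAddMonoidHom_coe] at h1
  rw [h2, inner_pow_eq_sum p h0 hy] at h1
  have h3 := congrArg (fun f => coeff f (n - 1)) h1
  simp only [coeff_derivative, finsetSum_coeff, coeff_smul] at h3
  have h4 : (n - 1 : ℕ) + 1 = n := by omega
  rw [h4] at h3
  rw [Nat.cast_smul_eq_nsmul, nsmul_eq_mul', ← h4, Nat.cast_succ, h4, h3, Finset.sum_filter]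
  refine Finset.sum_congr rfl fun c _ => ?_
  have hc : 0 < c.length := c.length_pos_iff.2 hp.out.pos
  rw [X_pow_mul, coeff_C_mul, coeff_X_pow]
  split_ifs with ha hb hb
  · rw [mul_one]
  · omega
  · omega
  · rw [mul_zero, smul_zero]

theorem add_pow_char_eq (h0 : y 0 = ξ) (hy : ∀ j, y (j + 1) = D * y j - y j * D) :
    (ξ + D) ^ p = ξ ^ p + D ^ p + ∑ n ∈ Finset.Icc 1 (p - 1), (n : k)⁻¹ •
      ∑ c : Composition p with c.length = n, bracketCoeff k p c.blocks •
        nestedBracket (c.blocks.map fun l => y (l - 1)) := by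
  have hp1 : p - 1 + 1 = p := Nat.sub_add_cancel hp.out.one_le
  set f : A[X] := X * C ξ + C D with hf
  have hdeg : f.natDegree ≤ 1 := by
    refine (natDegree_add_le _ _).trans (max_le ?_ (by simp))
    rw [X_mul]
    exact (natDegree_C_mul_le _ _).trans natDegree_X_le
  have hdegp : (f ^ p).natDegree < p + 1 := by
    have := natDegree_pow_le_of_le p hdeg
    omega
  -- Evaluation at `X = 1` is multiplicative over the noncommutative `A` because `1` is central.
  have h1 : eval₂RingHom' (RingHom.id A) 1 (fun a => Commute.one_right a) (f ^ p) = (ξ + D) ^ p := by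
    rw [map_pow, hf]
    simp [eval₂RingHom']
  have h2 : (f ^ p).coeff p = ξ ^ p := by
    have := coeff_pow_of_natDegree_le (m := p) hdeg
    rw [mul_one] at this
    rw [this, hf]
    simp
  have h3 : (f ^ p).coeff 0 = D ^ p := by
    rw [← constantCoeff_apply, map_pow, hf]
    simp
  have h4 : eval₂RingHom' (RingHom.id A) 1 (fun a => Commute.one_right a) (f ^ p) =
      ∑ n ∈ Finset.range (p + 1), (f ^ p).coeff n := by
    change eval₂ (RingHom.id A) 1 (f ^ p) = _
    rw [eval₂_eq_sum_range' _ hdegp]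
    simp
  have h5 : Finset.Ico (0 + 1) p = Finset.Icc 1 (p - 1) := by
    ext n
    rw [Finset.mem_Ico, Finset.mem_Icc]
    omega
  rw [← h1, h4, Finset.sum_range_succ, h2, Finset.range_eq_Ico,
    Finset.sum_eq_sum_Ico_succ_bot hp.out.pos, h3, h5,
    Finset.sum_congr rfl fun n hn => coeff_X_mul_add_pow (k := k) p h0 hy hn]
  abel

end PowerFormula

/-! ### Induction principles and derivations on `U(g)`. -/

section Enveloping

variable {k g : Type*} [Field k] [LieRing g] [LieAlgebra k g]

/-- By the universal property, the identity of `U(g)` factors through `W`. -/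
theorem mem_subalgebra_of_incl_mem (W : Subalgebra k (U k g)) (hW : ∀ x : g, incl k x ∈ W)
    (E : U k g) : E ∈ W := by
  let f : g →ₗ⁅k⁆ W :=
    { toFun := fun x => ⟨incl k x, hW x⟩
      map_add' := fun x y => Subtype.ext (map_add (UniversalEnvelopingAlgebra.ι k) x y)
      map_smul' := fun c x => Subtype.ext (map_smul (UniversalEnvelopingAlgebra.ι k) c x)
      map_lie' := fun {x y} => Subtype.ext (LieHom.map_lie (UniversalEnvelopingAlgebra.ι k) x y) }
  have h : W.val.comp (UniversalEnvelopingAlgebra.lift k f) = AlgHom.id k (U k g) := by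
    ext x
    change W.val (UniversalEnvelopingAlgebra.lift k f (UniversalEnvelopingAlgebra.ι k x)) = _
    rw [UniversalEnvelopingAlgebra.lift_ι_apply]
    rfl
  rw [← AlgHom.id_apply (R := k) E, ← h]
  exact (UniversalEnvelopingAlgebra.lift k f E).2

/-- `K` need not be a subalgebra, but the elements whose left multiplication preserves it form one.
-/
theorem mem_of_incl_mul_mem (K : Submodule k (U k g)) (h1 : 1 ∈ K)
    (hK : ∀ x : g, ∀ E ∈ K, incl k x * E ∈ K) (E : U k g) : E ∈ K := by
  let W : Subalgebra k (U k g) :=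
    { carrier := {E | ∀ z ∈ K, E * z ∈ K}
      mul_mem' := fun {a b} ha hb z hz => by
        rw [mul_assoc]
        exact ha _ (hb _ hz)
      add_mem' := fun {a b} ha hb z hz => by
        rw [add_mul]
        exact K.add_mem (ha _ hz) (hb _ hz)
      algebraMap_mem' := fun c z hz => by
        rw [← Algebra.smul_def]
        exact K.smul_mem _ hz }
  have := mem_subalgebra_of_incl_mem W hK E 1 h1
  rwa [mul_one] at this

theorem mem_of_mul_incl_mem (K : Submodule k (U k g)) (h1 : 1 ∈ K)
    (hK : ∀ x : g, ∀ E ∈ K, E * incl k x ∈ K) (E : U k g) : E ∈ K := by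
  let W : Subalgebra k (U k g) :=
    { carrier := {E | ∀ z ∈ K, z * E ∈ K}
      mul_mem' := fun {a b} ha hb z hz => by
        rw [← mul_assoc]
        exact hb _ (ha _ hz)
      add_mem' := fun {a b} ha hb z hz => by
        rw [mul_add]
        exact K.add_mem (ha _ hz) (hb _ hz)
      algebraMap_mem' := fun c z hz => by
        rw [← Algebra.commutes, ← Algebra.smul_def]
        exact K.smul_mem _ hz }
  have := mem_subalgebra_of_incl_mem W hK E 1 h1
  rwa [one_mul] at this

theorem incl_lie (x y : g) : incl k ⁅x, y⁆ = incl k x * incl k y - incl k y * incl k x :=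
  LieHom.map_lie (UniversalEnvelopingAlgebra.ι k) x y

theorem incl_add (x y : g) : incl k (x + y) = incl k x + incl k y :=
  map_add (UniversalEnvelopingAlgebra.ι k) x y

theorem incl_sub (x y : g) : incl k (x - y) = incl k x - incl k y :=
  map_sub (UniversalEnvelopingAlgebra.ι k) x y

theorem incl_smul (c : k) (x : g) : incl k (c • x) = c • incl k x :=
  map_smul (UniversalEnvelopingAlgebra.ι k) c x

/-- A linear endomorphism of an algebra that satisfies the Leibniz rule. -/
def IsLeibniz {A : Type*} [Ring A] [Algebra k A] (d : Module.End k A) : Prop :=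
  ∀ a b, d (a * b) = d a * b + a * d b

namespace IsLeibniz

section

variable {A : Type*} [Ring A] [Algebra k A] {d e : Module.End k A}

theorem map_one (hd : IsLeibniz d) : d 1 = 0 := by
  have := hd 1 1
  simpa using this

theorem add (hd : IsLeibniz d) (he : IsLeibniz e) : IsLeibniz (d + e) := fun a b => by
  rw [LinearMap.add_apply, LinearMap.add_apply, LinearMap.add_apply, hd, he, add_mul, mul_add]
  abel

theorem smul (c : k) (hd : IsLeibniz d) : IsLeibniz (c • d) := fun a b => by
  rw [LinearMap.smul_apply, LinearMap.smul_apply, LinearMap.smul_apply, hd, smul_add,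
    smul_mul_assoc, mul_smul_comm]

theorem commutator (hd : IsLeibniz d) (he : IsLeibniz e) : IsLeibniz (d * e - e * d) :=
  fun a b => by
    simp only [LinearMap.sub_apply, Module.End.mul_apply, hd _ _, he _ _, map_add]
    noncomm_ring

theorem inner_mulLeft (hd : IsLeibniz d) (a : A) :
    inner k d (LinearMap.mulLeft k a) = LinearMap.mulLeft k (d a) := by
  ext b
  rw [inner_apply, LinearMap.sub_apply, Module.End.mul_apply, Module.End.mul_apply,
    LinearMap.mulLeft_apply, LinearMap.mulLeft_apply, LinearMap.mulLeft_apply, hd,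
    add_sub_cancel_right]

theorem inner_pow_mulLeft (hd : IsLeibniz d) (a : A) (n : ℕ) :
    ((inner k d) ^ n) (LinearMap.mulLeft k a) = LinearMap.mulLeft k ((d ^ n) a) := by
  induction n with
  | zero => rfl
  | succ n ih => rw [pow_succ', Module.End.mul_apply, ih, hd.inner_mulLeft, pow_succ',
      Module.End.mul_apply]

/-- The Leibniz rule says that the commutator of `d` with left multiplication by `a` is left
multiplication by `d a`. Iterate `p` times and use `ad_d ^ p = ad_(d ^ p)`. -/
theorem pow_char (p : ℕ) [Fact p.Prime] [CharP k p] (hd : IsLeibniz d) : IsLeibniz (d ^ p) :=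
  fun a b => by
    have h := hd.inner_pow_mulLeft a p
    rw [inner_pow_char, inner_apply, sub_eq_iff_eq_add] at h
    exact LinearMap.congr_fun h b

end

theorem ext {d e : Module.End k (U k g)} (hd : IsLeibniz d) (he : IsLeibniz e)
    (h : ∀ x : g, d (incl k x) = e (incl k x)) : d = e := by
  ext E
  refine mem_of_incl_mul_mem (LinearMap.eqLocus d e) ?_ ?_ E
  · rw [LinearMap.mem_eqLocus, hd.map_one, he.map_one]
  · intro x E hE
    rw [LinearMap.mem_eqLocus] at hE ⊢
    rw [hd, he, hE, h]

end IsLeibniz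

/-- The Lie algebra morphism `g → U(g)[ε]` whose lift is `E ↦ E + ε d E`, `d` the extension of a
derivation of `g`. -/
def dualNumberHom (d : Module.End k g) (hd : ∀ x y, d ⁅x, y⁆ = ⁅d x, y⁆ + ⁅x, d y⁆) :
    g →ₗ⁅k⁆ TrivSqZeroExt (U k g) (U k g) where
  toFun x := TrivSqZeroExt.inl (incl k x) + TrivSqZeroExt.inr (incl k (d x))
  map_add' x y := by
    ext <;> simp [incl_add]
  map_smul' c x := by
    ext <;> simp [incl_smul]
  map_lie' {x y} := by
    ext
    · simp [incl_lie, LieRing.of_associative_ring_bracket]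
    · simp only [hd, incl_lie, incl_add, LieRing.of_associative_ring_bracket,
        TrivSqZeroExt.snd_add, TrivSqZeroExt.snd_inl, TrivSqZeroExt.snd_inr, zero_add,
        TrivSqZeroExt.snd_sub, TrivSqZeroExt.snd_mul, TrivSqZeroExt.fst_add,
        TrivSqZeroExt.fst_inl, TrivSqZeroExt.fst_inr, add_zero, smul_eq_mul,
        MulOpposite.smul_eq_mul_unop, MulOpposite.unop_op]
      abel

/-- The extension to `U(g)` of a derivation of `g`. -/
def envelopeDerivation (d : Module.End k g) (hd : ∀ x y, d ⁅x, y⁆ = ⁅d x, y⁆ + ⁅x, d y⁆) :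
    Module.End k (U k g) :=
  (TrivSqZeroExt.sndHom (U k g) (U k g)).restrictScalars k ∘ₗ
    (UniversalEnvelopingAlgebra.lift k (dualNumberHom d hd)).toLinearMap

theorem envelopeDerivation_incl (d : Module.End k g)
    (hd : ∀ x y, d ⁅x, y⁆ = ⁅d x, y⁆ + ⁅x, d y⁆) (x : g) :
    envelopeDerivation d hd (incl k x) = incl k (d x) := by
  change (UniversalEnvelopingAlgebra.lift k (dualNumberHom d hd)
    (UniversalEnvelopingAlgebra.ι k x)).snd = _
  rw [UniversalEnvelopingAlgebra.lift_ι_apply]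
  simp [dualNumberHom]

theorem isLeibniz_envelopeDerivation (d : Module.End k g)
    (hd : ∀ x y, d ⁅x, y⁆ = ⁅d x, y⁆ + ⁅x, d y⁆) : IsLeibniz (envelopeDerivation d hd) := by
  set F := UniversalEnvelopingAlgebra.lift k (dualNumberHom d hd) with hF
  have h : (TrivSqZeroExt.fstHom k (U k g) (U k g)).comp F = AlgHom.id k (U k g) := by
    ext x
    change (F (UniversalEnvelopingAlgebra.ι k x)).fst = _
    rw [hF, UniversalEnvelopingAlgebra.lift_ι_apply]
    simp [dualNumberHom, incl]
  have h' : ∀ E, (F E).fst = E := fun E => DFunLike.congr_fun h E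
  intro a b
  change (F (a * b)).snd = (F a).snd * b + a * (F b).snd
  rw [map_mul, TrivSqZeroExt.snd_mul, h', h', smul_eq_mul, MulOpposite.smul_eq_mul_unop,
    MulOpposite.unop_op, add_comm]

end Enveloping

/-! ### The sub-adjacent Lie algebra. -/

section SubAdjacent

variable {k g : Type*} [Field k] [LieRing g] [LieAlgebra k g]

/-- The sub-adjacent Lie algebra of a post-Lie algebra: `g` with the bracket
`x ▶ y - y ▶ x + ⁅x, y⁆`. -/
def SubAdjacent (_P : PostLieProduct k g) := g

namespace SubAdjacent

variable {P : PostLieProduct k g}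

instance : AddCommGroup (SubAdjacent P) := inferInstanceAs (AddCommGroup g)

instance : Module k (SubAdjacent P) := inferInstanceAs (Module k g)

variable (P) in
/-- The identity map from the sub-adjacent Lie algebra to `g`. -/
def val : SubAdjacent P →ₗ[k] g := LinearMap.id (M := g)

variable (P) in
/-- The identity map from `g` to the sub-adjacent Lie algebra. -/
def of : g →ₗ[k] SubAdjacent P := LinearMap.id (M := g)

@[simp] theorem val_of (x : g) : val P (of P x) = x := rfl

instance : Bracket (SubAdjacent P) (SubAdjacent P) where
  bracket x y := of P (P.op (val P x) (val P y) - P.op (val P y) (val P x) + ⁅val P x, val P y⁆)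

theorem val_lie (x y : SubAdjacent P) : val P ⁅x, y⁆ =
    P.op (val P x) (val P y) - P.op (val P y) (val P x) + ⁅val P x, val P y⁆ := rfl

theorem val_injective : Function.Injective (val P) := fun _ _ h => h

instance : LieRing (SubAdjacent P) where
  add_lie x y z := val_injective <| by
    simp only [val_lie, map_add, LinearMap.add_apply, add_lie]
    abel
  lie_add x y z := val_injective <| by
    simp only [val_lie, map_add, LinearMap.add_apply, lie_add]
    abel
  lie_self x := val_injective <| by
    simp only [val_lie, lie_self, sub_self, add_zero, map_zero]
  leibniz_lie x y z := val_injective <| by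
    simp only [val_lie, map_add, map_sub, LinearMap.add_apply, LinearMap.sub_apply, P.lie_op,
      P.op_lie, lie_add, add_lie, lie_sub, sub_lie]
    rw [leibniz_lie (val P x) (val P y) (val P z), ← lie_skew (val P y) (P.op (val P z) (val P x))]
    abel

instance : LieAlgebra k (SubAdjacent P) where
  lie_smul c x y := val_injective <| by
    simp only [val_lie, map_smul, LinearMap.smul_apply, lie_smul, smul_add, smul_sub]

end SubAdjacent

end SubAdjacent

variable {k g : Type*} [Field k] [LieRing g] [LieAlgebra k g]

/-! ### Solving the recursion on `U(g)`. -/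

section Recursion

open SubAdjacent

variable (P : PostLieProduct k g)

/-- The extension of `x ▶ ·` to a derivation of `U(g)`. -/
def opDerivation (x : g) : Module.End k (U k g) := envelopeDerivation (P.op x) (P.op_lie x)

theorem opDerivation_incl (x y : g) : opDerivation P x (incl k y) = incl k (P.op x y) :=
  envelopeDerivation_incl _ _ y

theorem isLeibniz_opDerivation (x : g) : IsLeibniz (opDerivation P x) :=
  isLeibniz_envelopeDerivation _ _

theorem opDerivation_add (x y : g) :
    opDerivation P (x + y) = opDerivation P x + opDerivation P y :=
  (isLeibniz_opDerivation P _).ext ((isLeibniz_opDerivation P x).add (isLeibniz_opDerivation P y))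
    fun z => by simp only [opDerivation_incl, map_add, LinearMap.add_apply, incl_add]

theorem opDerivation_smul (c : k) (x : g) : opDerivation P (c • x) = c • opDerivation P x :=
  (isLeibniz_opDerivation P _).ext ((isLeibniz_opDerivation P x).smul c)
    fun z => by simp only [opDerivation_incl, map_smul, LinearMap.smul_apply, incl_smul]

/-- The action of the sub-adjacent Lie algebra on `U(g)` by derivations. -/
def opDerivationHom : SubAdjacent P →ₗ⁅k⁆ Module.End k (U k g) where
  toFun x := opDerivation P (val P x)
  map_add' x y := by rw [map_add, opDerivation_add]
  map_smul' c x := by rw [map_smul, opDerivation_smul, RingHom.id_apply]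
  map_lie' {x y} := by
    rw [LieRing.of_associative_ring_bracket]
    refine (isLeibniz_opDerivation P _).ext
      ((isLeibniz_opDerivation P _).commutator (isLeibniz_opDerivation P _)) fun z => ?_
    simp only [opDerivation_incl, LinearMap.sub_apply, Module.End.mul_apply, val_lie, map_add,
      map_sub, LinearMap.add_apply, P.lie_op, incl_sub, incl_add]
    abel

variable {M : Type*} [AddCommGroup M] [Module k M]

/-- Right translation by `a` on the dual of the enveloping algebra of the sub-adjacent Lie
algebra. -/
def translation : SubAdjacent P →ₗ⁅k⁆ Module.End k (U k (SubAdjacent P) →ₗ[k] M) where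
  toFun a := LinearMap.lcomp k M (LinearMap.mulRight k (incl k a))
  map_add' a b := by
    ext f w
    simp [incl_add, mul_add]
  map_smul' c a := by
    ext f w
    simp [incl_smul]
  map_lie' {a b} := by
    ext f w
    simp [incl_lie, mul_sub, LieRing.of_associative_ring_bracket, mul_assoc]

theorem translation_apply (a : SubAdjacent P) (f : U k (SubAdjacent P) →ₗ[k] M)
    (w : U k (SubAdjacent P)) : translation P a f w = f (w * incl k a) := rfl

/-- The action of the sub-adjacent Lie algebra on `g ⊗ Hom(U, M)`. -/
def tensorAction :
    SubAdjacent P →ₗ⁅k⁆ Module.End k (g ⊗[k] (U k (SubAdjacent P) →ₗ[k] M)) where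
  toFun a := LinearMap.rTensor _ (P.op (val P a)) + LinearMap.lTensor _ (translation P a)
  map_add' a b := by
    ext x f
    simp
    abel
  map_smul' c a := by
    ext x f
    simp [TensorProduct.smul_tmul']
  map_lie' {a b} := by
    refine TensorProduct.ext' fun x f => ?_
    simp only [LinearMap.add_apply, LinearMap.rTensor_tmul, LinearMap.lTensor_tmul,
      LieRing.of_associative_ring_bracket, LinearMap.sub_apply, Module.End.mul_apply, map_add,
      LieHom.map_lie, val_lie, P.lie_op, TensorProduct.sub_tmul, TensorProduct.tmul_sub,
      TensorProduct.add_tmul, map_sub]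
    abel

theorem tensorAction_tmul (a : SubAdjacent P) (x : g) (f : U k (SubAdjacent P) →ₗ[k] M) :
    tensorAction P a (x ⊗ₜ f) = P.op (val P a) x ⊗ₜ f + x ⊗ₜ translation P a f := rfl

variable (d : SubAdjacent P →ₗ⁅k⁆ Module.End k M)

/-- The linear map `x ⊗ f ↦ d x (f 1) - f x`. -/
def baseValue : g ⊗[k] (U k (SubAdjacent P) →ₗ[k] M) →ₗ[k] M :=
  TensorProduct.lift <| LinearMap.mk₂ k (fun x f => d (of P x) (f 1) - f (incl k (of P x)))
    (fun x y f => by simp only [map_add, incl_add, LinearMap.add_apply]; abel)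
    (fun c x f => by simp only [map_smul, incl_smul, LinearMap.smul_apply, smul_sub])
    (fun x f f' => by simp only [map_add, LinearMap.add_apply]; abel)
    (fun c x f => by simp only [map_smul, LinearMap.smul_apply, smul_sub])

theorem baseValue_tmul (x : g) (f : U k (SubAdjacent P) →ₗ[k] M) :
    baseValue P d (x ⊗ₜ f) = d (of P x) (f 1) - f (incl k (of P x)) := rfl

/-- The operator `f ↦ (w ↦ baseValue (w (x ⊗ f)))`. -/
def coaction (x : g) : Module.End k (U k (SubAdjacent P) →ₗ[k] M) :=
  LinearMap.flip <| (LinearMap.lcomp k M (TensorProduct.mk k g _ x) ∘ₗ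
    LinearMap.llcomp k _ _ _ (baseValue P d)) ∘ₗ
      (UniversalEnvelopingAlgebra.lift k (tensorAction P (M := M))).toLinearMap

theorem coaction_apply (x : g) (f : U k (SubAdjacent P) →ₗ[k] M) (w : U k (SubAdjacent P)) :
    coaction P d x f w =
      baseValue P d (UniversalEnvelopingAlgebra.lift k (tensorAction P) w (x ⊗ₜ f)) := rfl

theorem coaction_one (x : g) (f : U k (SubAdjacent P) →ₗ[k] M) :
    coaction P d x f 1 = d (of P x) (f 1) - f (incl k (of P x)) := by
  rw [coaction_apply, map_one, Module.End.one_apply, baseValue_tmul]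

/-- With `f = f_E`, this reflects the Leibniz rule `a · (xE) = (a ▶ x) E + x (a · E)`. -/
theorem coaction_mul_incl (x : g) (f : U k (SubAdjacent P) →ₗ[k] M) (w : U k (SubAdjacent P))
    (a : SubAdjacent P) : coaction P d x f (w * incl k a) =
      coaction P d (P.op (val P a) x) f w + coaction P d x (translation P a f) w := by
  rw [coaction_apply, map_mul, Module.End.mul_apply, incl, UniversalEnvelopingAlgebra.lift_ι_apply,
    tensorAction_tmul, map_add, map_add, coaction_apply, coaction_apply]

theorem translation_coaction (x : g) (f : U k (SubAdjacent P) →ₗ[k] M) (a : SubAdjacent P) :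
    translation P a (coaction P d x f) =
      coaction P d (P.op (val P a) x) f + coaction P d x (translation P a f) := by
  ext w
  exact coaction_mul_incl P d x f w a

theorem coaction_add (x y : g) : coaction P d (x + y) = coaction P d x + coaction P d y := by
  ext f w
  simp only [coaction_apply, LinearMap.add_apply, TensorProduct.add_tmul, map_add]

theorem coaction_smul (c : k) (x : g) : coaction P d (c • x) = c • coaction P d x := by
  ext f w
  simp only [coaction_apply, LinearMap.smul_apply, ← TensorProduct.smul_tmul', map_smul]

/-- Induct on `w`. At `w = 1` the identity reduces to `d` respecting the sub-adjacent bracket;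
passing from `w` to `w a` uses that `a ▶ ·` is a derivation of the bracket of `g`. -/
theorem coaction_lie (x y : g) : coaction P d ⁅x, y⁆ =
    coaction P d x * coaction P d y - coaction P d y * coaction P d x := by
  -- Quantifying over `x`, `y` and `f` is needed, as removing a letter from `w` changes them.
  let K : Submodule k (U k (SubAdjacent P)) :=
    { carrier := {w | ∀ (x y : g) (f : U k (SubAdjacent P) →ₗ[k] M), coaction P d ⁅x, y⁆ f w =
        coaction P d x (coaction P d y f) w - coaction P d y (coaction P d x f) w}
      zero_mem' := fun x y f => by simp only [map_zero, sub_zero]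
      add_mem' := fun {a b} ha hb x y f => by
        simp only [map_add, ha x y f, hb x y f]
        abel
      smul_mem' := fun c a ha x y f => by
        simp only [map_smul, ha x y f, smul_sub] }
  have hK : ∀ w, w ∈ K := by
    refine mem_of_mul_incl_mem K ?_ ?_
    · intro x y f
      have h1 : of P ⁅x, y⁆ = ⁅of P x, of P y⁆ - of P (P.op x y) + of P (P.op y x) := by
        refine val_injective ?_
        simp only [map_add, map_sub, val_lie, val_of]
        abel
      have h3 : ∀ z a, coaction P d z f (incl k a) =
          coaction P d (P.op (val P a) z) f 1 + coaction P d z (translation P a f) 1 := by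
        intro z a
        rw [← coaction_mul_incl, one_mul]
      simp only [coaction_one, h3, h1, map_add, map_sub, LieHom.map_lie, incl_add, incl_sub,
        incl_lie, LinearMap.add_apply, LinearMap.sub_apply, translation_apply, one_mul,
        LieRing.of_associative_ring_bracket, Module.End.mul_apply, val_of]
      abel
    · intro a w hw x y f
      simp only [coaction_mul_incl, P.op_lie, translation_coaction, coaction_add,
        LinearMap.add_apply, map_add, hw _ _ _]
      abel
  ext f w
  exact hK w x y f

/-- The action of `g` on `Hom(U, M)` by the operators `coaction`. -/
def coactionHom : g →ₗ⁅k⁆ Module.End k (U k (SubAdjacent P) →ₗ[k] M) where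
  toFun := coaction P d
  map_add' := coaction_add P d
  map_smul' := coaction_smul P d
  map_lie' {x y} := coaction_lie P d x y

theorem translation_lift (a : SubAdjacent P) (f : U k (SubAdjacent P) →ₗ[k] M)
    (hf : translation P a f = 0) (E : U k g) :
    translation P a (UniversalEnvelopingAlgebra.lift k (coactionHom P d) E f) =
      UniversalEnvelopingAlgebra.lift k (coactionHom P d) (opDerivation P (val P a) E) f := by
  let L := UniversalEnvelopingAlgebra.lift k (coactionHom P d)
  have hL : ∀ x, L (incl k x) = coaction P d x := fun x =>
    UniversalEnvelopingAlgebra.lift_ι_apply k (coactionHom P d) x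
  refine mem_of_incl_mul_mem (LinearMap.eqLocus
    ((translation P a) ∘ₗ (LinearMap.flip L.toLinearMap f))
    ((LinearMap.flip L.toLinearMap f) ∘ₗ (opDerivation P (val P a)))) ?_ ?_ E
  · change translation P a (L 1 f) = L (opDerivation P (val P a) 1) f
    rw [(isLeibniz_opDerivation P _).map_one, map_one, map_zero, Module.End.one_apply, hf,
      LinearMap.zero_apply]
  · intro x E hE
    change translation P a (L E f) = L (opDerivation P (val P a) E) f at hE
    change translation P a (L (incl k x * E) f) = L (opDerivation P (val P a) (incl k x * E)) f
    rw [isLeibniz_opDerivation, map_mul, Module.End.mul_apply, hL, translation_coaction, hE,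
      opDerivation_incl, map_add, map_mul, map_mul, hL, hL, LinearMap.add_apply,
      Module.End.mul_apply, Module.End.mul_apply]

theorem exists_recursive_map (m : M) : ∃ Θ : U k g →ₗ[k] M, Θ 1 = m ∧
    ∀ x E, Θ (incl k x * E) = d (of P x) (Θ E) - Θ (opDerivation P x E) := by
  let L := UniversalEnvelopingAlgebra.lift k (coactionHom P d)
  let ε : U k (SubAdjacent P) →ₐ[k] k := UniversalEnvelopingAlgebra.lift k 0
  have hε : ∀ a, ε (incl k a) = 0 := fun a => by
    change ε (UniversalEnvelopingAlgebra.ι k a) = 0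
    rw [UniversalEnvelopingAlgebra.lift_ι_apply]
    rfl
  -- The forced choice for `f_1`: derivations kill `1`, so only the augmentation of `w` survives.
  let f : U k (SubAdjacent P) →ₗ[k] M := ε.toLinearMap.smulRight m
  have hf : ∀ a, translation P a f = 0 := fun a => by
    ext w
    change ε (w * incl k a) • m = 0
    rw [map_mul, hε, mul_zero, zero_smul]
  refine ⟨LinearMap.applyₗ 1 ∘ₗ LinearMap.flip L.toLinearMap f, ?_, fun x E => ?_⟩
  · change L 1 f 1 = m
    rw [map_one L]
    change ε 1 • m = m
    rw [map_one, one_smul]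
  · change L (incl k x * E) f 1 = d (of P x) (L E f 1) - L (opDerivation P x E) f 1
    have h := translation_lift P d (of P x) f (hf _) E
    rw [val_of] at h
    rw [← h, translation_apply, one_mul, map_mul, Module.End.mul_apply, ← coaction_one]
    congr 2
    exact UniversalEnvelopingAlgebra.lift_ι_apply k (coactionHom P d) x

/-- The term `opDerivation P x E` is not shorter than `E`, so plain induction on letters fails.
Requiring the claim for all images of `E` under words in the derivations makes the hypothesis stable
under them. -/
theorem recursive_map_mem {Q : U k g →ₗ[k] M} {S : Submodule k M} {e : g → M → M}
    (he : ∀ x, ∀ b ∈ S, e x b ∈ S) (h1 : Q 1 ∈ S)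
    (hQ : ∀ x E, Q (incl k x * E) = e x (Q E) - Q (opDerivation P x E)) (E : U k g) : Q E ∈ S := by
  let K : Submodule k (U k g) :=
    { carrier := {E | ∀ w : List g, Q ((w.map (opDerivation P)).prod E) ∈ S}
      zero_mem' := fun w => by simp only [map_zero, S.zero_mem]
      add_mem' := fun {a b} ha hb w => by
        rw [map_add, map_add]
        exact S.add_mem (ha w) (hb w)
      smul_mem' := fun c a ha w => by
        rw [map_smul, map_smul]
        exact S.smul_mem c (ha w) }
  suffices h : E ∈ K by simpa using h []
  have hD : ∀ a, ∀ E ∈ K, opDerivation P a E ∈ K := fun a E hE w => by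
    simpa using hE (w ++ [a])
  refine mem_of_incl_mul_mem K ?_ ?_ E
  · intro w
    induction w using List.reverseRecOn with
    | nil => simpa using h1
    | append_singleton w a _ =>
      simp [(isLeibniz_opDerivation P a).map_one]
  · intro x E hE w
    induction w using List.reverseRecOn generalizing x E with
    | nil =>
      simp only [List.map_nil, List.prod_nil, Module.End.one_apply, hQ]
      exact S.sub_mem (he _ _ (by simpa using hE [])) (by simpa using hE [x])
    | append_singleton w a ih =>
      simp only [List.map_append, List.prod_append, List.map_singleton, List.prod_singleton,
        Module.End.mul_apply, isLeibniz_opDerivation P a _ _, opDerivation_incl, map_add]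
      exact S.add_mem (ih _ _ hE) (ih _ _ (hD a E hE))

end Recursion

/-! ### Existence and uniqueness of the extension. -/

section Extension

open SubAdjacent

variable (P : PostLieProduct k g)

/-- The recursion characterising the extension of a post-Lie product to `U(g)`. -/
structure IsRecursive (T : U k g →ₗ[k] Module.End k (U k g)) : Prop where
  one_left : T 1 = 1
  incl_mul : ∀ x E, T (incl k x * E) = opDerivation P x * T E - T (opDerivation P x E)

theorem exists_isRecursive : ∃ T, IsRecursive P T := by
  let d : SubAdjacent P →ₗ⁅k⁆ Module.End k (Module.End k (U k g)) :=
    { toFun := fun x => LinearMap.mulLeft k (opDerivationHom P x)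
      map_add' := fun x y => by
        ext
        simp [add_mul]
      map_smul' := fun c x => by
        ext
        simp
      map_lie' := fun {x y} => by
        ext
        simp [LieRing.of_associative_ring_bracket, sub_mul, mul_assoc] }
  obtain ⟨T, h1, hT⟩ := exists_recursive_map P d 1
  exact ⟨T, h1, hT⟩

variable {P}

theorem coproduct_incl (x : g) : coproduct k g (incl k x) = incl k x ⊗ₜ 1 + 1 ⊗ₜ incl k x :=
  UniversalEnvelopingAlgebra.lift_ι_apply k (primitiveHom k g) x

-- `opDerivation P x` is a coderivation because it sends primitive generators to primitive elements.
variable (P) in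
theorem coproduct_opDerivation (x : g) (E : U k g) : coproduct k g (opDerivation P x E) =
    LinearMap.rTensor _ (opDerivation P x) (coproduct k g E) +
      LinearMap.lTensor _ (opDerivation P x) (coproduct k g E) := by
  have h1 := (isLeibniz_opDerivation P x).map_one
  refine mem_of_incl_mul_mem (LinearMap.eqLocus
    ((coproduct k g).toLinearMap ∘ₗ opDerivation P x)
    ((LinearMap.rTensor _ (opDerivation P x) + LinearMap.lTensor _ (opDerivation P x)) ∘ₗ
      (coproduct k g).toLinearMap)) ?_ ?_ E
  · simp only [LinearMap.mem_eqLocus, LinearMap.comp_apply, AlgHom.toLinearMap_apply, map_one,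
      LinearMap.add_apply, Algebra.TensorProduct.one_def, LinearMap.rTensor_tmul,
      LinearMap.lTensor_tmul, h1, TensorProduct.zero_tmul, TensorProduct.tmul_zero, map_zero,
      add_zero]
  · intro y E hE
    simp only [LinearMap.mem_eqLocus, LinearMap.comp_apply, AlgHom.toLinearMap_apply,
      LinearMap.add_apply] at hE ⊢
    rw [isLeibniz_opDerivation, map_add, map_mul, map_mul, hE, opDerivation_incl, map_mul,
      coproduct_incl, coproduct_incl]
    generalize coproduct k g E = z
    induction z using TensorProduct.induction_on with
    | zero => simp only [mul_zero, map_zero, add_zero]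
    | tmul a b =>
      simp only [add_mul, mul_add, Algebra.TensorProduct.tmul_mul_tmul, LinearMap.rTensor_tmul,
        LinearMap.lTensor_tmul, map_add, one_mul, isLeibniz_opDerivation P x _ _,
        opDerivation_incl, TensorProduct.add_tmul, TensorProduct.tmul_add]
      abel
    | add a b ha hb =>
      simp only [mul_add, map_add] at ha hb ⊢
      refine Eq.trans ?_ ((congrArg₂ (· + ·) ha hb).trans ?_) <;> abel

namespace IsRecursive

variable {T : U k g →ₗ[k] Module.End k (U k g)}

theorem incl_left (hT : IsRecursive P T) (x : g) : T (incl k x) = opDerivation P x := by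
  have h := hT.incl_mul x 1
  rwa [mul_one, hT.one_left, mul_one, (isLeibniz_opDerivation P x).map_one, map_zero,
    sub_zero] at h

/-- The product `(E₍₁₎ ▶ F₁) (E₍₂₎ ▶ F₂)`, as a function of `E`. -/
def sweedlerProduct (T : U k g →ₗ[k] U k g →ₗ[k] U k g) (F₁ F₂ : U k g) : U k g →ₗ[k] U k g :=
  LinearMap.mul' k (U k g) ∘ₗ TensorProduct.map (T.flip F₁) (T.flip F₂) ∘ₗ
    (coproduct k g).toLinearMap

theorem sweedlerProduct_apply (F₁ F₂ E : U k g) : sweedlerProduct T F₁ F₂ E =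
    LinearMap.mul' k (U k g) (TensorProduct.map (LinearMap.flip T F₁) (LinearMap.flip T F₂)
      (coproduct k g E)) := rfl

theorem sweedlerProduct_one (hT : IsRecursive P T) (F₁ F₂ : U k g) :
    sweedlerProduct T F₁ F₂ 1 = F₁ * F₂ := by
  rw [sweedlerProduct_apply, map_one, Algebra.TensorProduct.one_def, TensorProduct.map_tmul,
    LinearMap.mul'_apply, LinearMap.flip_apply, LinearMap.flip_apply, hT.one_left]
  rfl

theorem sweedlerProduct_incl_mul (hT : IsRecursive P T) (F₁ F₂ : U k g) (x : g) (E : U k g) :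
    sweedlerProduct T F₁ F₂ (incl k x * E) =
      opDerivation P x (sweedlerProduct T F₁ F₂ E) -
        sweedlerProduct T F₁ F₂ (opDerivation P x E) := by
  rw [sweedlerProduct_apply, sweedlerProduct_apply, sweedlerProduct_apply, coproduct_opDerivation,
    map_mul, coproduct_incl]
  generalize coproduct k g E = z
  induction z using TensorProduct.induction_on with
  | zero => simp only [mul_zero, map_zero, add_zero, sub_zero]
  | tmul a b =>
    simp only [add_mul, Algebra.TensorProduct.tmul_mul_tmul, LinearMap.rTensor_tmul,
      LinearMap.lTensor_tmul, map_add, one_mul, TensorProduct.map_tmul, LinearMap.mul'_apply,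
      LinearMap.flip_apply, hT.incl_mul, LinearMap.sub_apply, Module.End.mul_apply,
      isLeibniz_opDerivation P x _ _, sub_mul, mul_sub]
    abel
  | add a b ha hb =>
    rw [mul_add]
    simp only [map_add] at ha hb ⊢
    rw [ha, hb]
    abel

/-- Both sides, as functions of `E`, satisfy the same recursion with the same value at `1`, so their
difference lies in the zero subspace. -/
theorem apply_mul (hT : IsRecursive P T) (E F₁ F₂ : U k g) :
    T E (F₁ * F₂) = sweedlerProduct T F₁ F₂ E := by
  let Q : U k g →ₗ[k] U k g := LinearMap.flip T (F₁ * F₂) - sweedlerProduct T F₁ F₂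
  have h := recursive_map_mem (Q := Q) (S := ⊥) P (e := fun x => opDerivation P x)
    (fun x b hb => by rw [(Submodule.mem_bot k).1 hb, map_zero]; exact Submodule.zero_mem _) ?_ ?_ E
  · exact sub_eq_zero.1 ((Submodule.mem_bot k).1 h)
  · rw [Submodule.mem_bot]
    change T 1 (F₁ * F₂) - _ = 0
    rw [hT.sweedlerProduct_one, hT.one_left, Module.End.one_apply, sub_self]
  · intro x E
    change T _ (F₁ * F₂) - _ = opDerivation P x (T E (F₁ * F₂) - _) - (T _ (F₁ * F₂) - _)
    rw [hT.sweedlerProduct_incl_mul, hT.incl_mul, LinearMap.sub_apply, Module.End.mul_apply, map_sub]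
    abel

theorem isEnvelopeExtension (hT : IsRecursive P T) : IsEnvelopeExtension P T where
  incl_incl x y := by rw [hT.incl_left, opDerivation_incl]
  one_left F := by rw [hT.one_left, Module.End.one_apply]
  incl_mul x E F := by
    rw [hT.incl_mul, hT.incl_left]
    rfl
  right_mul E F₁ F₂ := hT.apply_mul E F₁ F₂

/-- Since `x` is primitive and `1` acts as the identity, the product rule makes `T x` a derivation,
determined by its values on `g`. -/
theorem of_isEnvelopeExtension {T : U k g →ₗ[k] U k g →ₗ[k] U k g} (h : IsEnvelopeExtension P T) :
    IsRecursive P T := by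
  have hx : ∀ x, T (incl k x) = opDerivation P x := fun x => by
    refine IsLeibniz.ext (fun a b => ?_) (isLeibniz_opDerivation P x) fun y => ?_
    · rw [h.right_mul, coproduct_incl, map_add, map_add, TensorProduct.map_tmul,
        TensorProduct.map_tmul, LinearMap.mul'_apply, LinearMap.mul'_apply]
      simp only [LinearMap.flip_apply, h.one_left]
    · rw [h.incl_incl, opDerivation_incl]
  refine ⟨LinearMap.ext h.one_left, fun x E => LinearMap.ext fun F => ?_⟩
  rw [h.incl_mul, hx]
  rfl

theorem unique {T' : U k g →ₗ[k] Module.End k (U k g)} (hT : IsRecursive P T)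
    (hT' : IsRecursive P T') : T' = T := by
  ext1 E
  have h := recursive_map_mem (Q := T' - T) (S := ⊥) P (e := fun x f => opDerivation P x * f)
    (fun x b hb => by rw [(Submodule.mem_bot k).1 hb, mul_zero]; exact Submodule.zero_mem _) ?_ ?_ E
  · exact sub_eq_zero.1 ((Submodule.mem_bot k).1 h)
  · rw [LinearMap.sub_apply, hT.one_left, hT'.one_left, sub_self]
    exact Submodule.zero_mem _
  · intro x E
    simp only [LinearMap.sub_apply, hT.incl_mul, hT'.incl_mul, mul_sub]
    abel

/-- The recursion reads `T (x E + L_x E) = L_x T(E)`; iterate from `E = 1`. -/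
theorem add_pow_apply_one (hT : IsRecursive P T) (x : g) (n : ℕ) :
    T (((LinearMap.mulLeft k (incl k x) + opDerivation P x) ^ n) 1) = opDerivation P x ^ n := by
  induction n with
  | zero => simpa using hT.one_left
  | succ n ih =>
    rw [pow_succ', Module.End.mul_apply, LinearMap.add_apply, LinearMap.mulLeft_apply, map_add,
      hT.incl_mul, sub_add_cancel, ih, pow_succ']

end IsRecursive

end Extension

/-! ### Invariance of the restricted ideal and descent. -/

section Restricted

variable {p : ℕ} {R : PMap k g p} {P : PostLieProduct k g}

theorem bullet_succ (x : g) (j : ℕ) : P.bullet x (j + 1) = (P.op x ^ j) x := rfl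

theorem inner_pow_incl (x : g) (n : ℕ) (z : g) : ((inner k (incl k x)) ^ n) (incl k z) =
    incl k ((LieAlgebra.ad k g x ^ n) z) := by
  induction n with
  | zero => rfl
  | succ n ih => rw [pow_succ', Module.End.mul_apply, ih, pow_succ', Module.End.mul_apply,
      LieAlgebra.ad_apply, incl_lie, inner_apply]

theorem mem_restrictedIdeal_relation (R : PMap k g p) (x : g) :
    incl k x ^ p - incl k (R.toFun x) ∈ restrictedIdeal R :=
  TwoSidedIdeal.subset_span ⟨x, rfl⟩

/-- The ideal `restrictedIdeal R`, as a subspace of `U(g)`. -/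
def restrictedSubmodule (R : PMap k g p) : Submodule k (U k g) where
  carrier := restrictedIdeal R
  zero_mem' := (restrictedIdeal R).zero_mem
  add_mem' := (restrictedIdeal R).add_mem
  smul_mem' c x hx := by
    rw [Algebra.smul_def]
    exact (restrictedIdeal R).mul_mem_left _ _ hx

theorem proj_eq_iff {E F : U k g} : proj R E = proj R F ↔ E - F ∈ restrictedIdeal R := by
  rw [← TwoSidedIdeal.rel_iff]
  exact RingCon.eq _

theorem proj_surjective (R : PMap k g p) : Function.Surjective (proj R) :=
  RingCon.mk'_surjective _

theorem existsUnique_quotient_op (T : U k g →ₗ[k] U k g →ₗ[k] U k g)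
    (hT : ∀ E ∈ restrictedIdeal R, ∀ F, T E F ∈ restrictedIdeal R ∧ T F E ∈ restrictedIdeal R) :
    ∃! S : RestrictedEnvelope R →ₗ[k] RestrictedEnvelope R →ₗ[k] RestrictedEnvelope R,
      ∀ E F : U k g, S (proj R E) (proj R F) = proj R (T E F) := by
  -- A linear section makes the quotient operation bilinear at once; invariance of the ideal removes
  -- the dependence on the section.
  obtain ⟨σ, hσ⟩ := (proj R).toLinearMap.exists_rightInverse_of_surjective
    (LinearMap.range_eq_top.2 (proj_surjective R))
  have hσ' : ∀ u, proj R (σ u) = u := fun u => LinearMap.congr_fun hσ u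
  have hS₀ : ∀ E F, ((T.compl₁₂ σ σ).compr₂ (proj R).toLinearMap) (proj R E) (proj R F) =
      proj R (T E F) := by
    intro E F
    change proj R (T (σ (proj R E)) (σ (proj R F))) = proj R (T E F)
    have h : ∀ E, σ (proj R E) - E ∈ restrictedIdeal R := fun E => proj_eq_iff.1 (hσ' _)
    have h1 := (hT _ (h E) (σ (proj R F))).1
    have h2 := (hT _ (h F) E).2
    rw [map_sub, LinearMap.sub_apply] at h1
    rw [map_sub] at h2
    exact (proj_eq_iff.2 h1).trans (proj_eq_iff.2 h2)
  refine ⟨_, hS₀, fun S hS => LinearMap.ext fun u => LinearMap.ext fun v => ?_⟩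
  obtain ⟨E, rfl⟩ := proj_surjective R u
  obtain ⟨F, rfl⟩ := proj_surjective R v
  rw [hS, hS₀]

variable [hp : Fact p.Prime] [CharP k p]

/-- The iterated commutators of `L_x` with left multiplication by `x` are left multiplications by
the elements `P.bullet x (j + 1)`, so Jacobson's formula reproduces the sub-adjacent correction. -/
theorem add_pow_char_apply_one (R : PMap k g p) (P : PostLieProduct k g) (x : g) :
    ((LinearMap.mulLeft k (incl k x) + opDerivation P x) ^ p) 1 =
      incl k x ^ p + incl k (subadjacentPMap R P x - R.toFun x) := by
  have hL := isLeibniz_opDerivation P x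
  rw [add_pow_char_eq (k := k) p (ξ := LinearMap.mulLeft k (incl k x)) (D := opDerivation P x)
    (y := fun j => LinearMap.mulLeft k (incl k (P.bullet x (j + 1)))) rfl fun j => ?_]
  · have h0 : (opDerivation P x ^ p) 1 = 0 := by
      rw [← Nat.sub_add_cancel hp.out.one_le, pow_succ, Module.End.mul_apply, hL.map_one, map_zero]
    rw [LinearMap.add_apply, LinearMap.add_apply, h0, add_zero, LinearMap.pow_mulLeft,
      LinearMap.mulLeft_apply, mul_one, subadjacentPMap, add_sub_cancel_left]
    congr 1
    let m : g →ₗ[k] Module.End k (U k g) :=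
      LinearMap.mul k (U k g) ∘ₗ (UniversalEnvelopingAlgebra.ι k : g →ₗ⁅k⁆ U k g).toLinearMap
    have hm : ∀ z, m z 1 = incl k z := fun z => mul_one _
    have hml : ∀ y z, m ⁅y, z⁆ = ⁅m y, m z⁆ := fun y z => by
      ext b
      change incl k ⁅y, z⁆ * b = incl k y * (incl k z * b) - incl k z * (incl k y * b)
      rw [incl_lie]
      noncomm_ring
    rw [← hm]
    refine LinearMap.congr_fun ?_ 1
    simp only [map_sum, map_smul]
    refine Finset.sum_congr rfl fun n _ => congrArg _ (Finset.sum_congr rfl fun c hc => ?_)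
    congr 1
    · rw [bracketCoeff, c.blocks_length, (Finset.mem_filter.1 hc).2]
      rfl
    · refine Eq.trans ?_ (nestedBracket_map m.toAddMonoidHom hml (c.blocks.map (P.bullet x)))
      rw [List.map_map]
      refine congrArg _ (List.map_congr_left fun l hl => ?_)
      rw [Nat.sub_add_cancel (c.one_le_blocks hl)]
      rfl
  · rw [bullet_succ, bullet_succ, ← inner_apply (k := k), hL.inner_mulLeft, opDerivation_incl, pow_succ',
      Module.End.mul_apply]

theorem opDerivation_relation (hP : TriviallyRestricted R P) (x y : g) :
    opDerivation P y (incl k x ^ p - incl k (R.toFun x)) = 0 := by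
  have h := leibniz_pow_char (k := k) p (opDerivation P y).toAddMonoidHom
    (isLeibniz_opDerivation P y) (incl k x)
  simp only [LinearMap.toAddMonoidHom_coe] at h
  rw [map_sub, h, opDerivation_incl, opDerivation_incl, hP.op_pMap, inner_pow_incl, sub_self]

/-- Both `x^p` and `x^[p]` act on `g` by the commutator as `(ad x)^p`, so their difference commutes
with the generators. -/
theorem relation_commute (R : PMap k g p) (x : g) (E : U k g) :
    E * (incl k x ^ p - incl k (R.toFun x)) = (incl k x ^ p - incl k (R.toFun x)) * E := by
  set c := incl k x ^ p - incl k (R.toFun x) with hc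
  refine mem_subalgebra_of_incl_mem (Subalgebra.centralizer k {c}) (fun y => ?_) E c rfl |>.symm
  rw [Subalgebra.mem_centralizer_iff]
  rintro _ rfl
  have h := inner_pow_incl (k := k) x p y
  rw [inner_pow_char, inner_apply, ← R.ad_map, LieAlgebra.ad_apply, incl_lie, sub_eq_sub_iff_add_eq_add] at h
  rw [hc, sub_mul, mul_sub, sub_eq_sub_iff_add_eq_add, h]
  abel

theorem restrictedIdeal_induction {K : Submodule k (U k g)}
    (hK : ∀ x E, E * (incl k x ^ p - incl k (R.toFun x)) ∈ K) {E : U k g}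
    (hE : E ∈ restrictedIdeal R) : E ∈ K := by
  let s : Set (U k g) :=
    {z | ∃ x E, z = E * (incl k x ^ p - incl k (R.toFun x))}
  let J : TwoSidedIdeal (U k g) := TwoSidedIdeal.mk' (Submodule.span k s) (Submodule.zero_mem _)
    (Submodule.add_mem _) (Submodule.neg_mem _)
    (fun {a b} hb => by
      have : Submodule.span k s ≤ (Submodule.span k s).comap (LinearMap.mulLeft k a) := by
        rw [Submodule.span_le]
        rintro _ ⟨x, E, rfl⟩
        exact Submodule.subset_span ⟨x, a * E, (mul_assoc _ _ _).symm⟩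
      exact this hb)
    (fun {a b} ha => by
      have : Submodule.span k s ≤ (Submodule.span k s).comap (LinearMap.mulRight k b) := by
        rw [Submodule.span_le]
        rintro _ ⟨x, E, rfl⟩
        refine Submodule.subset_span ⟨x, E * b, ?_⟩
        rw [LinearMap.mulRight_apply, mul_assoc, mul_assoc, relation_commute]
      exact this ha)
  have hJ : restrictedIdeal R ≤ J := by
    rw [restrictedIdeal, TwoSidedIdeal.span_le]
    rintro _ ⟨x, rfl⟩
    exact (TwoSidedIdeal.mem_mk' _ _ _ _ _ _ _).2 (Submodule.subset_span ⟨x, 1, (one_mul _).symm⟩)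
  have h := (TwoSidedIdeal.mem_mk' _ _ _ _ _ _ _).1 (hJ hE)
  refine Submodule.span_le.2 ?_ h
  rintro _ ⟨x, E, rfl⟩
  exact hK x E

theorem opDerivation_mem (hP : TriviallyRestricted R P) (y : g) {E : U k g}
    (hE : E ∈ restrictedIdeal R) : opDerivation P y E ∈ restrictedIdeal R := by
  refine restrictedIdeal_induction (K := (restrictedSubmodule R).comap (opDerivation P y)) ?_ hE
  intro x E
  rw [Submodule.mem_comap, isLeibniz_opDerivation, opDerivation_relation hP, mul_zero, add_zero]
  exact (restrictedIdeal R).mul_mem_left _ _ (mem_restrictedIdeal_relation R x)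

namespace IsRecursive

variable {T : U k g →ₗ[k] Module.End k (U k g)}

theorem relation_eq_zero (hT : IsRecursive P T) (hP : TriviallyRestricted R P) (x : g) :
    T (incl k x ^ p - incl k (R.toFun x)) = 0 := by
  have h := hT.add_pow_apply_one x p
  rw [add_pow_char_apply_one R P x, incl_sub, map_add, map_sub, hT.incl_left, hT.incl_left] at h
  -- Both sides are derivations, so it suffices to compare them on `g`, where this is the first
  -- restrictedness condition.
  have h2 : opDerivation P x ^ p = opDerivation P (subadjacentPMap R P x) := by
    refine ((isLeibniz_opDerivation P x).pow_char p).ext (isLeibniz_opDerivation P _) fun y => ?_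
    have hn : ∀ n : ℕ, (opDerivation P x ^ n) (incl k y) = incl k ((P.op x ^ n) y) := by
      intro n
      induction n with
      | zero => rfl
      | succ n ih => rw [pow_succ', Module.End.mul_apply, ih, opDerivation_incl, pow_succ',
          Module.End.mul_apply]
    rw [hn, opDerivation_incl, hP.subadjacent_op]
  rw [h2, add_sub, sub_eq_iff_eq_add, add_comm] at h
  rw [map_sub, hT.incl_left, sub_eq_zero]
  exact add_left_cancel h

theorem apply_mem_right (hT : IsRecursive P T) (hP : TriviallyRestricted R P) (F : U k g)
    {E : U k g} (hE : E ∈ restrictedIdeal R) : T F E ∈ restrictedIdeal R := by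
  let Q : U k g →ₗ[k] U k g := LinearMap.flip T E
  have := recursive_map_mem (Q := Q) (S := restrictedSubmodule R) P
    (e := fun x => opDerivation P x) (fun x b hb => opDerivation_mem hP x hb) ?_ ?_ F
  · exact this
  · change T 1 E ∈ restrictedIdeal R
    rwa [hT.one_left]
  · intro x F
    change T _ E = opDerivation P x (T F E) - T _ E
    rw [hT.incl_mul]
    rfl

theorem apply_mem_left (hT : IsRecursive P T) (hP : TriviallyRestricted R P) (F : U k g)
    {E : U k g} (hE : E ∈ restrictedIdeal R) : T E F ∈ restrictedIdeal R := by
  refine restrictedIdeal_induction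
    (K := (restrictedSubmodule R).comap (LinearMap.flip T F : U k g →ₗ[k] U k g)) ?_ hE
  intro x E
  rw [Submodule.mem_comap]
  let c := incl k x ^ p - incl k (R.toFun x)
  -- Since the derivations kill `c`, the map `E ↦ T (E c) F` obeys the same recursion, starting from
  -- `T c F = 0`.
  let Q : U k g →ₗ[k] U k g := (LinearMap.flip T F : U k g →ₗ[k] U k g) ∘ₗ LinearMap.mulRight k c
  refine recursive_map_mem (Q := Q) (S := restrictedSubmodule R) P
    (e := fun x => opDerivation P x) (fun x b hb => opDerivation_mem hP x hb) ?_ ?_ E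
  · change T (1 * c) F ∈ restrictedIdeal R
    rw [one_mul, hT.relation_eq_zero hP]
    exact (restrictedIdeal R).zero_mem
  · intro y E
    change T (incl k y * E * c) F = opDerivation P y (T (E * c) F) - T (opDerivation P y E * c) F
    rw [mul_assoc, hT.incl_mul, isLeibniz_opDerivation, opDerivation_relation hP, mul_zero, add_zero]
    rfl

end IsRecursive

end Restricted

end RestrictedPostLie

end

open RestrictedPostLie in
theorem mainTheorem5 {k : Type*} {g : Type*} [Field k] [LieRing g] [LieAlgebra k g]
    (p : ℕ) [Fact p.Prime] [CharP k p]
    (R : PMap k g p) (P : PostLieProduct k g) (hP : TriviallyRestricted R P) :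
    ∃ T : U k g →ₗ[k] U k g →ₗ[k] U k g,
      IsEnvelopeExtension P T ∧
      (∀ T' : U k g →ₗ[k] U k g →ₗ[k] U k g, IsEnvelopeExtension P T' → T' = T) ∧
      (∀ E ∈ restrictedIdeal R, ∀ F : U k g,
        T E F ∈ restrictedIdeal R ∧ T F E ∈ restrictedIdeal R) ∧
      ∃! S : RestrictedEnvelope R →ₗ[k] RestrictedEnvelope R →ₗ[k] RestrictedEnvelope R,
        ∀ E F : U k g, S (proj R E) (proj R F) = proj R (T E F) := by
  obtain ⟨T, hT⟩ := exists_isRecursive P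
  have h : ∀ E ∈ restrictedIdeal R, ∀ F : U k g,
      T E F ∈ restrictedIdeal R ∧ T F E ∈ restrictedIdeal R :=
    fun E hE F => ⟨hT.apply_mem_left hP F hE, hT.apply_mem_right hP F hE⟩
  exact ⟨T, hT.isEnvelopeExtension,
    fun T' hT' => hT.unique (IsRecursive.of_isEnvelopeExtension hT'), h,
    existsUnique_quotient_op T h⟩
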